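/- \textbf{Definitions.} Write $\mathbb N=\{1,2,\dots\}$; for a finite or infinite $S\subseteq\mathbb N$ let $S(k)$ be its $k$-th element in increasing order, and write $t\sqsubseteq s$ if $t$ is an initial segment of $s$. Let $\mathcal F$ be a family of finite subsets of $\mathbb N$ and $\widehat{\mathcal F}=\{t:\ t\sqsubseteq s\text{ for some }s\in\mathcal F\}$. $\mathcal F$ is \emph{thin} if $s\sqsubseteq t$ with $s,t\in\mathcal F$ implies $s=t$; it is \emph{regular thin} if it is thin and $\widehat{\mathcal F}$ is hereditary (closed under subsets), spreading (if $\{n_1<\dots<n_k\}\in\widehat{\mathcal F}$, $m_1<\dots<m_k$ and $n_i\le m_i$ for all $i$, then $\{m_1,\dots,m_k\}\in\widehat{\mathcal F}$) and compact (the characteristic functions of its members form a closed subset of $\{0,1\}^{\mathbb N}$). The order $o(\mathcal F)$ is the rank of $\emptyset$ in the tree $(\widehat{\mathcal F},\sqsubseteq)$, where the rank of $s$ is $\sup\{\operatorname{rank}(t)+1:\ t\in\widehat{\mathcal F},\ s\sqsubsetneq t\}$; it is $\omega_1$ if the tree is ill-founded, and $o(\emptyset)=-1$. A tuple $(s_j)_{j=1}^l$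 of nonempty finite subsets of $\mathbb N$ is \emph{plegma} if $s_i(k)<s_j(k)$ whenever $i<j$ and $1\le k\le\min(|s_i|,|s_j|)$, and $s_i(k)<s_j(k+1)$ for all $i,j$ and all $k$ with $1\le k\le\min(|s_i|,|s_j|-1)$. An \emph{$\mathcal F$-sequence} in a set $A$ is a map $s\mapsto x_s$ from $\mathcal F$ to $A$. Let $X$ be a real Banach space and $(e_n)_{n\in\mathbb N}$ a Hamel basis of a real seminormed space $(E,\|\cdot\|_*)$. An $\mathcal F$-sequence $(x_s)_{s\in\mathcal F}$ in $X$ \emph{admits $(e_n)_n$ as an $\mathcal F$-spreading model} if there are an infinite $M\subseteq\mathbb N$ and a null sequence $(\delta_l)_{l\in\mathbb N}$ of positive reals such that $$\Big|\,\Big\|\sum_{j=1}^k a_jx_{s_j}\Big\|-\Big\|\sum_{j=1}^k a_je_j\Big\|_*\Big|\le\delta_l$$ for all $1\le k\le l$, all plegma $k$-tuples $(s_j)_{j=1}^k$ of members of $\mathcal F$ contained in $M$ with $s_1(1)\ge M(l)$, and all $a_1,\dots,a_k\in[-1,1]$. For $A\subseteq X$, $(e_n)_n$ is an \emph{$\mathcal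 F$-spreading model of $A$} if some $\mathcal F$-sequence in $A$ admits it. For $1\le\xi<\omega_1$, $\mathcal{SM}_\xi(A)$ is the class of all $(e_n)_n$ that are an $\mathcal F$-spreading model of $A$ for some regular thin $\mathcal F$ with $o(\mathcal F)=\xi$. \textbf{Statement.} Let $X$ be a real Banach space. (1) Let $\mathcal F,\mathcal G$ be regular thin families with $1\le o(\mathcal F)\le o(\mathcal G)$, and let $(x_s)_{s\in\mathcal F}$ be an $\mathcal F$-sequence in $X$ that admits $(e_n)_n$ as an $\mathcal F$-spreading model. Then there is a $\mathcal G$-sequence $(x'_t)_{t\in\mathcal G}$ with $\{x'_t:t\in\mathcal G\}\subseteq\{x_s:s\in\mathcal F\}$ that admits the same $(e_n)_n$ as a $\mathcal G$-spreading model. (2) Let $\mathcal F,\mathcal G$ be regular thin families with $o(\mathcal F)=o(\mathcal G)$ and let $A\subseteq X$. Then $(e_n)_n$ is an $\mathcal F$-spreading model of $A$ if and only if it is a $\mathcal G$-spreading model of $A$. (3) For every $A\subseteq X$ and all $1\le\zeta<\xi<\omega_1$, $\mathcal{SM}_\zeta(A)\subseteq\mathcal{SM}_\xi(A)$; in particular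 $\mathcal{SM}_\zeta(X)\subseteq\mathcal{SM}_\xi(X)$. -/

import Mathlib

open Filter Topology
open scoped Ordinal

/-! The natural numbers are indexed from `0`: `nthElem S k` is the element of `S` that has exactly
`k` elements of `S` below it, so the first element of `S` is `nthElem S 0`. -/

namespace SpreadingModels

/-- The `k`-th element (counting from `0`) of a set `S` of natural numbers in its increasing
enumeration. For finite `S` it is only used for `k < |S|`. -/
noncomputable def nthElem (S : Set ℕ) (k : ℕ) : ℕ := Nat.nth (fun n => n ∈ S) k

/-- `t` is an initial segment of `s`. -/
def InitSeg (t s : Finset ℕ) : Prop := t ⊆ s ∧ ∀ a ∈ t, ∀ b ∈ s, b ∉ t → a < b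

/-- `t` is a proper initial segment of `s`. -/
def ProperInitSeg (t s : Finset ℕ) : Prop := InitSeg t s ∧ t ≠ s

/-- The closure of a family under initial segments. -/
def segClosure (F : Set (Finset ℕ)) : Set (Finset ℕ) := {t | ∃ s ∈ F, InitSeg t s}

/-- Closed under taking subsets. -/
def IsHereditary (F : Set (Finset ℕ)) : Prop := ∀ s ∈ F, ∀ t, t ⊆ s → t ∈ F

/-- If `{n₁ < ⋯ < n_k} ∈ F`, `m₁ < ⋯ < m_k` and `n_i ≤ m_i` for all `i`, then
`{m₁, …, m_k} ∈ F`. -/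
def IsSpreading (F : Set (Finset ℕ)) : Prop :=
  ∀ (k : ℕ) (n m : Fin k → ℕ), StrictMono n → StrictMono m → (∀ i, n i ≤ m i) →
    Finset.univ.image n ∈ F → Finset.univ.image m ∈ F

/-- The characteristic functions of the members of `F` form a closed subset of `{0,1}^ℕ`. -/
def IsCompactFamily (F : Set (Finset ℕ)) : Prop :=
  IsClosed ((fun (s : Finset ℕ) (n : ℕ) => decide (n ∈ s)) '' F : Set (ℕ → Bool))

/-- A regular family: compact, hereditary and spreading. -/
structure IsRegular (F : Set (Finset ℕ)) : Prop where
  compact : IsCompactFamily F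
  hereditary : IsHereditary F
  spreading : IsSpreading F

/-- No member of `F` is an initial segment of another member. -/
def IsThin (F : Set (Finset ℕ)) : Prop := ∀ s ∈ F, ∀ t ∈ F, InitSeg s t → s = t

/-- A regular thin family: thin, with regular closure. -/
structure IsRegularThin (F : Set (Finset ℕ)) : Prop where
  thin : IsThin F
  regular : IsRegular (segClosure F)

/-- `t` is a proper extension of `s` in the tree `segClosure F`. -/
def TreeExt (F : Set (Finset ℕ)) (t s : Finset ℕ) : Prop :=
  t ∈ segClosure F ∧ ProperInitSeg s t

open Classical in
/-- The order `o(F)`, where `⊥` stands for `-1`. It is `⊥` for the empty family, `ω₁` if the tree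
`segClosure F` is ill-founded, and otherwise the rank of `∅` in that tree, where the rank of `s` is
the supremum of `rank t + 1` over the proper extensions `t` of `s` in the tree. -/
noncomputable def order (F : Set (Finset ℕ)) : WithBot Ordinal.{0} :=
  if F = ∅ then ⊥
  else if h : WellFounded (TreeExt F) then ((h.apply ∅).rank : Ordinal.{0})
  else (ω₁ : Ordinal.{0})

/-- Plegma tuples of nonempty finite sets of natural numbers. -/
structure IsPlegma {l : ℕ} (s : Fin l → Finset ℕ) : Prop where
  nonempty : ∀ i, (s i).Nonempty
  lt : ∀ i j, i < j → ∀ k, k < (s i).card → k < (s j).card →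
    nthElem (s i) k < nthElem (s j) k
  lt_succ : ∀ i j, ∀ k, k < (s i).card → k + 1 < (s j).card →
    nthElem (s i) k < nthElem (s j) (k + 1)

section

variable {X : Type*} [NormedAddCommGroup X] [NormedSpace ℝ X]
  {E : Type*} [SeminormedAddCommGroup E] [NormedSpace ℝ E]

/-- For an infinite set `M`, the `F`-subsequence of `x` given by the members of `F` contained in
`M` generates the Hamel basis `e` of the seminormed space `E` as an `F`-spreading model.
As elements are counted from `0`, the error `δ l` belongs to plegma tuples of length at
most `l + 1` that start at or after the element `nthElem M l` of `M`. -/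
def Generates {F : Set (Finset ℕ)} (x : F → X) (M : Set ℕ) (e : Module.Basis ℕ ℝ E) : Prop :=
  ∃ δ : ℕ → ℝ, (∀ l, 0 < δ l) ∧ Tendsto δ atTop (𝓝 0) ∧
    ∀ (l k : ℕ) (hk : 0 < k), k ≤ l + 1 →
      ∀ s : Fin k → F, (∀ j, ((s j : Finset ℕ) : Set ℕ) ⊆ M) →
        IsPlegma (fun j => (s j : Finset ℕ)) →
        nthElem M l ≤ nthElem ((s ⟨0, hk⟩ : Finset ℕ) : Set ℕ) 0 →
        ∀ a : Fin k → ℝ, (∀ j, a j ∈ Set.Icc (-1 : ℝ) 1) →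
          |‖∑ j, a j • x (s j)‖ - ‖∑ j, a j • e (j : ℕ)‖| ≤ δ l

/-- The `F`-sequence `x` admits `e` as an `F`-spreading model. -/
def Admits {F : Set (Finset ℕ)} (x : F → X) (e : Module.Basis ℕ ℝ E) : Prop :=
  ∃ M : Set ℕ, M.Infinite ∧ Generates x M e

/-- `e` is an `F`-spreading model of the set `A`. -/
def IsSpreadingModelOf (F : Set (Finset ℕ)) (A : Set X) (e : Module.Basis ℕ ℝ E) : Prop :=
  ∃ x : F → X, (∀ s, x s ∈ A) ∧ Admits x e

variable (E) in
/-- `SM_ξ(A)`: the `ξ`-spreading models of `A`, as Hamel bases of the seminormed space `E`. -/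
def SM (ξ : Ordinal.{0}) (A : Set X) : Set (Module.Basis ℕ ℝ E) :=
  {e | ∃ F : Set (Finset ℕ), IsRegularThin F ∧ order F = (ξ : WithBot Ordinal.{0}) ∧
    IsSpreadingModelOf F A e}

end

end SpreadingModels

/-! For (1), two sequences indexed by finite index sets `σ` are compared. Choose `p` in `M` so
sparse that any `σ.image p` in the tree of `F` but outside `F` can be prolonged by every later `p k`
(`exists_strictMono_insert_mem`). Then choose `q` inductively so that the `F`-rank of `σ.image p`
never exceeds the `G`-rank of `σ.image q`; hence `q` carries tree members to tree members
(`exists_strictMono_image_mem`). If `u.image q` is in `G`, some initial segment `σ` of `u` has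
`σ.image p` in `F`: otherwise `u.image p` could be prolonged, hence also `u.image q` in the tree of
`G`, against thinness. Put `x'` at `u.image q` equal to `x` at `σ.image p`. Plegma conditions are
order relations between indices, so they survive shortening and replacing `q` by `p`, and the same
`δ` serves on the range of `q`.

Part (2) is (1) used in both directions; orders below `1` leave only `∅` and `{∅}`. Part (3) also
needs a regular thin family of each countable order `ξ`: the maximal sets whose elements carry
decreasing labels below `ξ`, with codes bounded by the elements (`exists_isRegularThin_order_eq`).
-/

namespace SpreadingModels

/-! ### Initial segments -/

theorem InitSeg.refl (s : Finset ℕ) : InitSeg s s :=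
  ⟨subset_rfl, fun _ _ _ hb h => absurd hb h⟩

theorem InitSeg.empty (s : Finset ℕ) : InitSeg ∅ s := ⟨Finset.empty_subset s, by simp⟩

theorem InitSeg.trans {r s t : Finset ℕ} (h₁ : InitSeg r s) (h₂ : InitSeg s t) : InitSeg r t := by
  refine ⟨h₁.1.trans h₂.1, fun a ha b hb hbr => ?_⟩
  by_cases hbs : b ∈ s
  · exact h₁.2 a ha b hbs hbr
  · exact h₂.2 a (h₁.1 ha) b hb hbs

theorem InitSeg.image {s t : Finset ℕ} (h : InitSeg s t) {f : ℕ → ℕ} (hf : StrictMono f) :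
    InitSeg (s.image f) (t.image f) := by
  refine ⟨Finset.image_subset_image h.1, ?_⟩
  simp only [Finset.mem_image]
  rintro _ ⟨a, ha, rfl⟩ _ ⟨b, hb, rfl⟩ hbs
  exact hf (h.2 a ha b hb fun hb' => hbs ⟨b, hb', rfl⟩)

theorem ProperInitSeg.image {s t : Finset ℕ} (h : ProperInitSeg s t) {f : ℕ → ℕ}
    (hf : StrictMono f) : ProperInitSeg (s.image f) (t.image f) :=
  ⟨h.1.image hf, fun he => h.2 (Finset.image_injective hf.injective he)⟩

theorem ProperInitSeg.card_lt {s t : Finset ℕ} (h : ProperInitSeg s t) : s.card < t.card :=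
  Finset.card_lt_card (h.1.1.ssubset_of_ne h.2)

theorem properInitSeg_insert {s : Finset ℕ} {m : ℕ} (hm : ∀ a ∈ s, a < m) :
    ProperInitSeg s (insert m s) := by
  have hms : m ∉ s := fun h => (hm m h).false
  refine ⟨⟨Finset.subset_insert m s, fun a ha b hb hbs => ?_⟩, fun h => hms ?_⟩
  · rcases Finset.mem_insert.1 hb with rfl | hb
    · exact hm a ha
    · exact absurd hb hbs
  · rw [h]; exact Finset.mem_insert_self m s

/-- A proper initial segment of `t` can be prolonged by the next element of `t`. -/
theorem ProperInitSeg.exists_insert {s t : Finset ℕ} (h : ProperInitSeg s t) :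
    ∃ m ∈ t, (∀ a ∈ s, a < m) ∧ InitSeg (insert m s) t := by
  have hne : (t \ s).Nonempty := by
    rw [Finset.sdiff_nonempty]
    exact fun hts => h.2 (h.1.1.antisymm hts)
  have hmem := Finset.mem_sdiff.1 (Finset.min'_mem _ hne)
  refine ⟨(t \ s).min' hne, hmem.1, fun a ha => h.1.2 a ha _ hmem.1 hmem.2,
    Finset.insert_subset hmem.1 h.1.1, fun a ha b hb hbs => ?_⟩
  have hb' : b ∉ s := fun hbs' => hbs (Finset.mem_insert_of_mem hbs')
  rcases Finset.mem_insert.1 ha with rfl | ha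
  · refine lt_of_le_of_ne (Finset.min'_le _ _ (Finset.mem_sdiff.2 ⟨hb, hb'⟩)) fun he => hbs ?_
    rw [he]; exact Finset.mem_insert_self _ _
  · exact h.1.2 a ha b hb hb'

theorem subset_segClosure (F : Set (Finset ℕ)) : F ⊆ segClosure F :=
  fun s hs => ⟨s, hs, InitSeg.refl s⟩

theorem mem_segClosure_of_initSeg {F : Set (Finset ℕ)} {s t : Finset ℕ} (ht : t ∈ segClosure F)
    (h : InitSeg s t) : s ∈ segClosure F :=
  let ⟨u, hu, htu⟩ := ht
  ⟨u, hu, h.trans htu⟩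

theorem empty_mem_segClosure {F : Set (Finset ℕ)} (hF : F.Nonempty) : ∅ ∈ segClosure F :=
  let ⟨s, hs⟩ := hF
  ⟨s, hs, InitSeg.empty s⟩

theorem exists_insert_mem_segClosure {F : Set (Finset ℕ)} {s : Finset ℕ} (hs : s ∈ segClosure F)
    (hsF : s ∉ F) : ∃ m, (∀ a ∈ s, a < m) ∧ insert m s ∈ segClosure F := by
  obtain ⟨t, ht, hst⟩ := hs
  obtain ⟨m, -, hm, hmt⟩ := ProperInitSeg.exists_insert ⟨hst, fun h => hsF (h ▸ ht)⟩
  exact ⟨m, hm, t, ht, hmt⟩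

theorem IsSpreading.image_mem {R : Set (Finset ℕ)} (hR : IsSpreading R) {f : ℕ → ℕ}
    (hf : StrictMono f) {s : Finset ℕ} (hs : s ∈ R) : s.image f ∈ R := by
  have himg := Finset.image_orderEmbOfFin_univ s rfl
  have := hR s.card (s.orderEmbOfFin rfl) (fun i => f (s.orderEmbOfFin rfl i))
    (s.orderEmbOfFin rfl).strictMono (hf.comp (s.orderEmbOfFin rfl).strictMono)
    (fun i => hf.id_le _) (by rwa [himg])
  rwa [← Function.comp_def f, ← Finset.image_image, himg] at this

/-- The map that fixes the numbers below `m` and translates the others by `d`. -/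
def shiftFrom (m d n : ℕ) : ℕ := if n < m then n else n + d

theorem shiftFrom_strictMono (m d : ℕ) : StrictMono (shiftFrom m d) := by
  intro a b h
  simp only [shiftFrom]
  split_ifs <;> omega

theorem image_shiftFrom_insert {s : Finset ℕ} {m : ℕ} (hm : ∀ a ∈ s, a < m) (d : ℕ) :
    (insert m s).image (shiftFrom m d) = insert (m + d) s := by
  have h : s.image (shiftFrom m d) = s := by
    conv_rhs => rw [← Finset.image_id (s := s)]
    exact Finset.image_congr fun a ha => by simp [shiftFrom, hm a ha]
  rw [Finset.image_insert, h]
  simp [shiftFrom]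

theorem IsSpreading.insert_mem {R : Set (Finset ℕ)} (hR : IsSpreading R) {s : Finset ℕ} {m n : ℕ}
    (hm : ∀ a ∈ s, a < m) (hmn : m ≤ n) (h : insert m s ∈ R) : insert n s ∈ R := by
  obtain ⟨d, rfl⟩ := Nat.exists_eq_add_of_le hmn
  rw [← image_shiftFrom_insert hm d]
  exact hR.image_mem (shiftFrom_strictMono m d) h

/-! ### Well-foundedness and rank -/

/-- The characteristic functions along an infinite branch converge to that of its union. Compactness
makes this union finite, yet it contains sets of unbounded cardinality. -/
theorem wellFounded_treeExt {F : Set (Finset ℕ)} (hF : IsCompactFamily (segClosure F)) :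
    WellFounded (TreeExt F) := by
  rw [wellFounded_iff_isEmpty_descending_chain]
  refine ⟨fun ⟨f, hf⟩ => ?_⟩
  have hsub : Monotone f := monotone_nat_of_le_succ fun n => (hf n).2.1.1
  have hcard : ∀ n, n ≤ (f n).card := by
    intro n
    induction n with
    | zero => exact Nat.zero_le _
    | succ n ih => exact ih.trans_lt (hf n).2.card_lt
  classical
  have hlim : Tendsto (fun n i => decide (i ∈ f (n + 1))) atTop
      (𝓝 fun i => decide (∃ n, i ∈ f n)) := by
    rw [tendsto_pi_nhds]
    intro i
    refine tendsto_const_nhds.congr' ?_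
    by_cases h : ∃ n, i ∈ f n
    · obtain ⟨n, hn⟩ := h
      filter_upwards [eventually_ge_atTop n] with k hk
      have h1 : i ∈ f (k + 1) := hsub (hk.trans k.le_succ) hn
      have h2 : ∃ n, i ∈ f n := ⟨n, hn⟩
      simp only [h1, h2]
    · refine Eventually.of_forall fun k => ?_
      have h1 : i ∉ f (k + 1) := fun hi => h ⟨_, hi⟩
      simp only [h, h1]
  obtain ⟨s, -, hs⟩ := hF.mem_of_tendsto hlim
    (Eventually.of_forall fun n => ⟨f (n + 1), (hf n).1, rfl⟩)
  have hle : f (s.card + 1) ⊆ s := by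
    intro i hi
    have := congrFun hs i
    have h2 : ∃ n, i ∈ f n := ⟨_, hi⟩
    simpa [h2] using this
  have := (hcard (s.card + 1)).trans (Finset.card_le_card hle)
  omega

theorem IsRegularThin.wellFounded {F : Set (Finset ℕ)} (hF : IsRegularThin F) :
    WellFounded (TreeExt F) := wellFounded_treeExt hF.regular.compact

theorem order_eq_rank {F : Set (Finset ℕ)} (hne : F.Nonempty) (h : WellFounded (TreeExt F)) :
    order F = ((h.apply ∅).rank : Ordinal.{0}) := by
  rw [order, if_neg hne.ne_empty, dif_pos h]

section rank

variable {F : Set (Finset ℕ)} (h : WellFounded (TreeExt F))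

/-- By spreading, `f` maps the extensions of `s` in the tree to extensions of `s.image f` and
preserves proper initial segments. -/
theorem rank_le_rank_image (hF : IsSpreading (segClosure F)) {f : ℕ → ℕ} (hf : StrictMono f)
    (s : Finset ℕ) : (h.apply s).rank ≤ (h.apply (s.image f)).rank := by
  induction s using h.induction with
  | _ s ih =>
    rw [(h.apply s).rank_eq]
    refine Ordinal.iSup_le fun ⟨t, ht⟩ => Order.succ_le_of_lt ((ih t ht).trans_lt ?_)
    exact (h.apply (s.image f)).rank_lt_of_rel ⟨hF.image_mem hf ht.1, ht.2.image hf⟩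

/-- An extension witnessing the rank passes through a one-point extension `insert m s` of at least
its rank. A shift fixing `s` and moving `m` to `n` does not lower the rank. -/
theorem exists_le_rank_insert (hF : IsSpreading (segClosure F)) {s : Finset ℕ} {α : Ordinal.{0}}
    (hα : α < (h.apply s).rank) :
    ∃ m, ∀ n, m ≤ n → insert n s ∈ segClosure F ∧ α ≤ (h.apply (insert n s)).rank := by
  rw [(h.apply s).rank_eq, Ordinal.lt_iSup_iff] at hα
  obtain ⟨⟨t, ht⟩, hαt⟩ := hα
  obtain ⟨m, -, hm, hmt⟩ := ht.2.exists_insert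
  have hins : insert m s ∈ segClosure F := mem_segClosure_of_initSeg ht.1 hmt
  have hle : α ≤ (h.apply (insert m s)).rank := by
    refine (Order.lt_succ_iff.1 hαt).trans ?_
    by_cases he : insert m s = t
    · subst he; exact le_rfl
    · exact ((h.apply _).rank_lt_of_rel ⟨ht.1, hmt, he⟩).le
  refine ⟨m, fun n hmn => ⟨hF.insert_mem hm hmn hins, hle.trans ?_⟩⟩
  obtain ⟨d, rfl⟩ := Nat.exists_eq_add_of_le hmn
  rw [← image_shiftFrom_insert hm d]
  exact rank_le_rank_image h hF (shiftFrom_strictMono m d) _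

end rank

/-! ### Increasing enumerations -/

theorem nthElem_eq_of_mem {s : Finset ℕ} {a : ℕ} (ha : a ∈ s) :
    nthElem s (s.filter (· < a)).card = a := by
  have hp : (fun n => n ∈ (s : Set ℕ)) a := ha
  classical
  have hc : Nat.count (fun n => n ∈ (s : Set ℕ)) a = (s.filter (· < a)).card := by
    rw [Nat.count_eq_card_filter_range]
    congr 1
    ext i
    simp [and_comm]
  rw [nthElem, ← hc]
  exact Nat.nth_count hp

theorem exists_mem_card_filter_lt_eq {s : Finset ℕ} {k : ℕ} (hk : k < s.card) :
    ∃ a ∈ s, (s.filter (· < a)).card = k ∧ nthElem s k = a := by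
  classical
  have hlt : ∀ hf : (Set.ofPred fun n => n ∈ (s : Set ℕ)).Finite, k < hf.toFinset.card := by
    intro hf
    convert hk
    ext i
    simp
  have hmem := Nat.nth_mem k hlt
  have hc := Nat.count_nth hlt
  refine ⟨_, hmem, ?_, rfl⟩
  rw [Nat.count_eq_card_filter_range] at hc
  conv_rhs => rw [← hc]
  congr 1
  ext i
  simp [and_comm]

theorem InitSeg.nthElem_eq {s t : Finset ℕ} (h : InitSeg s t) {k : ℕ} (hk : k < s.card) :
    nthElem t k = nthElem s k := by
  obtain ⟨a, ha, hc, hn⟩ := exists_mem_card_filter_lt_eq hk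
  have hf : t.filter (· < a) = s.filter (· < a) := by
    ext b
    simp only [Finset.mem_filter]
    refine ⟨fun hb => ⟨?_, hb.2⟩, fun hb => ⟨h.1 hb.1, hb.2⟩⟩
    by_contra hbs
    exact absurd (h.2 a ha b hb.1 hbs) hb.2.not_gt
  rw [hn, ← hc, ← hf]
  exact nthElem_eq_of_mem (h.1 ha)

theorem nthElem_image {f : ℕ → ℕ} (hf : StrictMono f) {s : Finset ℕ} {k : ℕ} (hk : k < s.card) :
    nthElem (s.image f : Finset ℕ) k = f (nthElem s k) := by
  obtain ⟨a, ha, hc, hn⟩ := exists_mem_card_filter_lt_eq hk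
  have h := nthElem_eq_of_mem (Finset.mem_image_of_mem f ha)
  rw [Finset.filter_image, Finset.card_image_of_injective _ hf.injective] at h
  simp only [hf.lt_iff_lt, hc] at h
  rw [h, hn]

theorem nthElem_range {f : ℕ → ℕ} (hf : StrictMono f) (k : ℕ) : nthElem (Set.range f) k = f k := by
  have hinf : (Set.ofPred fun n => n ∈ Set.range f).Infinite :=
    Set.infinite_range_of_injective hf.injective
  have := Nat.nth_comp_of_strictMono (p := fun n => n ∈ Set.range f) (n := k) hf (fun _ h => h)
    fun hfi => absurd hfi hinf
  rw [nthElem, ← this]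
  simp

theorem nthElem_le_of_strictMono {M : Set ℕ} (hM : M.Infinite) {f : ℕ → ℕ} (hf : StrictMono f)
    (hfM : ∀ k, f k ∈ M) (k : ℕ) : nthElem M k ≤ f k := by
  have hinf : (Set.ofPred fun n => n ∈ M).Infinite := hM
  induction k with
  | zero =>
    rw [nthElem, Nat.nth_zero]
    exact Nat.sInf_le (hfM 0)
  | succ k ih =>
    by_contra! hlt
    have := Nat.le_nth_of_lt_nth_succ hlt (hfM (k + 1))
    exact absurd (this.trans ih) (hf k.lt_succ_self).not_ge

theorem IsPlegma.of_nthElem {l : ℕ} {s v : Fin l → Finset ℕ} (hs : IsPlegma s)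
    (hne : ∀ j, (v j).Nonempty) (hcard : ∀ j, (v j).card ≤ (s j).card)
    (hlt : ∀ i j k k', k < (v i).card → k' < (v j).card →
      nthElem (s i) k < nthElem (s j) k' → nthElem (v i) k < nthElem (v j) k') : IsPlegma v where
  nonempty := hne
  lt i j hij k hi hj := hlt i j k k hi hj
    (hs.lt i j hij k (hi.trans_le (hcard i)) (hj.trans_le (hcard j)))
  lt_succ i j k hi hj := hlt i j k (k + 1) hi hj
    (hs.lt_succ i j k (hi.trans_le (hcard i)) (hj.trans_le (hcard j)))

/-! ### Diagonal sequences -/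

/-- Only finitely many `σ` lie below `k`, so all their demands on `q k`, which may depend on the
values already chosen, can be met at once. -/
theorem exists_strictMono_diagonal {M : Set ℕ} (hM : M.Infinite)
    (b : Finset ℕ → Finset ℕ → ℕ → ℕ) :
    ∃ q : ℕ → ℕ, StrictMono q ∧ (∀ k, q k ∈ M) ∧
      ∀ k σ, (∀ a ∈ σ, a < k) → b σ (σ.image q) k ≤ q k := by
  choose g hgM hg using fun n : ℕ => hM.exists_gt n
  -- The first sum dominates every demand; the second forces strict growth.
  let Φ : ℕ → (ℕ → ℕ) → ℕ := fun k f =>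
    g (∑ σ ∈ (Finset.range k).powerset, b σ (σ.image f) k + ∑ m ∈ Finset.range k, f m)
  let q : ℕ → ℕ := (Nat.lt_wfRel.wf).fix fun k r => Φ k fun m => if h : m < k then r m h else 0
  have hq : ∀ k, q k = Φ k fun m => if m < k then q m else 0 := by
    intro k
    have := (Nat.lt_wfRel.wf).fix_eq
      (fun k (r : ∀ m, m < k → ℕ) => Φ k fun m => if h : m < k then r m h else 0) k
    exact this
  have hb : ∀ k σ, (∀ a ∈ σ, a < k) → b σ (σ.image q) k ≤ q k := by
    intro k σ hσ
    have him : σ.image (fun m => if m < k then q m else 0) = σ.image q :=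
      Finset.image_congr fun a ha => by simp [hσ a ha]
    rw [hq k, ← him]
    refine le_trans ?_ (hg _).le
    refine le_trans ?_ (Nat.le_add_right _ _)
    exact Finset.single_le_sum (f := fun σ => b σ (σ.image fun m => if m < k then q m else 0) k)
      (fun _ _ => Nat.zero_le _)
      (Finset.mem_powerset.2 fun a ha => Finset.mem_range.2 (hσ a ha))
  refine ⟨q, strictMono_nat_of_lt_succ fun n => ?_, fun k => ?_, hb⟩
  · rw [hq (n + 1)]
    refine lt_of_le_of_lt ?_ (hg _)
    refine le_trans ?_ (Nat.le_add_left _ _)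
    have := Finset.single_le_sum (f := fun m => if m < n + 1 then q m else 0)
      (fun _ _ => Nat.zero_le _) (Finset.self_mem_range_succ n)
    simpa using this
  · rw [hq k]; exact hgM _

/-- Along a suitable sequence in `M`, every non-maximal member of the tree of `F` can be prolonged
by every later term. -/
theorem exists_strictMono_insert_mem {F : Set (Finset ℕ)} (hF : IsSpreading (segClosure F))
    {M : Set ℕ} (hM : M.Infinite) :
    ∃ p : ℕ → ℕ, StrictMono p ∧ (∀ k, p k ∈ M) ∧ ∀ k (σ : Finset ℕ), (∀ a ∈ σ, a < k) →
      σ.image p ∈ segClosure F → σ.image p ∉ F → (insert k σ).image p ∈ segClosure F := by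
  have hex : ∀ t : Finset ℕ, ∃ m, t ∈ segClosure F → t ∉ F → ∀ n, m ≤ n →
      insert n t ∈ segClosure F := by
    intro t
    by_cases ht : t ∈ segClosure F ∧ t ∉ F
    · obtain ⟨m, hm, hins⟩ := exists_insert_mem_segClosure ht.1 ht.2
      exact ⟨m, fun _ _ n hn => hF.insert_mem hm hn hins⟩
    · exact ⟨0, fun h1 h2 => absurd ⟨h1, h2⟩ ht⟩
  choose b hb using hex
  obtain ⟨p, hp, hpM, hbp⟩ := exists_strictMono_diagonal hM fun _ t _ => b t
  refine ⟨p, hp, hpM, fun k σ hσ h1 h2 => ?_⟩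
  rw [Finset.image_insert]
  exact hb _ h1 h2 _ (hbp k σ hσ)

/-- If the rank of the tree of `F` is at most that of the spreading tree of `G`, then some strictly
increasing map carries the former into the latter. -/
theorem exists_strictMono_image_mem {F G : Set (Finset ℕ)} (hF : WellFounded (TreeExt F))
    (hG : WellFounded (TreeExt G)) (hGne : G.Nonempty) (hGs : IsSpreading (segClosure G))
    (hle : (hF.apply ∅).rank ≤ (hG.apply ∅).rank) {p : ℕ → ℕ} (hp : StrictMono p) :
    ∃ q : ℕ → ℕ, StrictMono q ∧
      ∀ σ : Finset ℕ, σ.image p ∈ segClosure F → σ.image q ∈ segClosure G := by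
  have hex : ∀ (σ t : Finset ℕ) (k : ℕ), ∃ m,
      (hF.apply ((insert k σ).image p)).rank < (hG.apply t).rank → ∀ n, m ≤ n →
        insert n t ∈ segClosure G ∧
          (hF.apply ((insert k σ).image p)).rank ≤ (hG.apply (insert n t)).rank := by
    intro σ t k
    by_cases h : (hF.apply ((insert k σ).image p)).rank < (hG.apply t).rank
    · obtain ⟨m, hm⟩ := exists_le_rank_insert hG hGs h
      exact ⟨m, fun _ => hm⟩
    · exact ⟨0, fun h' => absurd h' h⟩
  choose b hb using hex
  obtain ⟨q, hq, -, hbq⟩ := exists_strictMono_diagonal Set.infinite_univ b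
  -- The rank inequality is the induction invariant: adjoining `k` strictly lowers the `F`-rank,
  -- which leaves room for a step in the tree of `G`.
  have key : ∀ σ : Finset ℕ, σ.image p ∈ segClosure F →
      σ.image q ∈ segClosure G ∧
        (hF.apply (σ.image p)).rank ≤ (hG.apply (σ.image q)).rank := by
    intro σ
    induction σ using Finset.induction_on_max with
    | empty => exact fun _ => ⟨empty_mem_segClosure hGne, hle⟩
    | insert k σ hσ ih =>
      intro hmem
      have hpr : ProperInitSeg (σ.image p) ((insert k σ).image p) :=
        (properInitSeg_insert hσ).image hp
      obtain ⟨-, hrank⟩ := ih (mem_segClosure_of_initSeg hmem hpr.1)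
      have hlt := ((hF.apply (σ.image p)).rank_lt_of_rel ⟨hmem, hpr⟩).trans_le hrank
      have := hb σ (σ.image q) k hlt (q k) (hbq k σ hσ)
      rwa [← Finset.image_insert] at this
  exact ⟨q, hq, fun σ hσ => (key σ hσ).1⟩

/-! ### Transfer of spreading models -/

variable {X : Type*} [NormedAddCommGroup X] [NormedSpace ℝ X]
  {E : Type*} [SeminormedAddCommGroup E] [NormedSpace ℝ E]

theorem exists_admits_of_rank_le {F G : Set (Finset ℕ)} (hF : IsRegularThin F)
    (hG : IsRegularThin G) (hFne : F.Nonempty) (hGne : G.Nonempty) (hF0 : ∅ ∉ F)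
    (hle : (hF.wellFounded.apply ∅).rank ≤ (hG.wellFounded.apply ∅).rank)
    (x : F → X) (e : Module.Basis ℕ ℝ E) (hx : Admits x e) :
    ∃ x' : G → X, Set.range x' ⊆ Set.range x ∧ Admits x' e := by
  obtain ⟨M, hM, δ, hδ0, hδ, hgen⟩ := hx
  obtain ⟨p, hp, hpM, hpins⟩ := exists_strictMono_insert_mem hF.regular.spreading hM
  obtain ⟨q, hq, hpq⟩ := exists_strictMono_image_mem hF.wellFounded hG.wellFounded hGne
    hG.regular.spreading hle hp
  -- Members of `G` not contained in the range of `q` get an arbitrary value.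
  have hex : ∀ t : G, ∃ s : F, ∀ u : Finset ℕ, (t : Finset ℕ) = u.image q →
      ∃ σ, InitSeg σ u ∧ (s : Finset ℕ) = σ.image p := by
    rintro ⟨t, ht⟩
    by_cases htq : ∃ u : Finset ℕ, t = u.image q
    · obtain ⟨u, rfl⟩ := htq
      suffices h : ∃ σ, InitSeg σ u ∧ σ.image p ∈ F by
        obtain ⟨σ, hσ, hσF⟩ := h
        exact ⟨⟨_, hσF⟩, fun v hv => ⟨σ, Finset.image_injective hq.injective hv ▸ hσ, rfl⟩⟩
      by_contra! hno
      -- If no segment of `u` lands in `F`, segments of `u` in the tree keep growing beyond the size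
      -- of `u`; growth past `u` itself is excluded by thinness of `G`.
      have hnext : ∀ n, ∃ σ, InitSeg σ u ∧ σ.image p ∈ segClosure F ∧ n ≤ σ.card := by
        intro n
        induction n with
        | zero => exact ⟨∅, InitSeg.empty u, by simpa using empty_mem_segClosure hFne, by simp⟩
        | succ n ih =>
          obtain ⟨σ, hσ, hσF, hn⟩ := ih
          by_cases he : σ = u
          · subst he
            obtain ⟨k, hk⟩ : ∃ k, ∀ a ∈ σ, a < k :=
              ⟨σ.sup id + 1, fun a ha => Nat.lt_succ_of_le (Finset.le_sup (f := id) ha)⟩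
            have hmem := hpq _ (hpins k σ hk hσF (hno σ hσ))
            obtain ⟨w, hw, hsw⟩ := hmem
            have hpr := (properInitSeg_insert hk).image hq
            have heq := hG.thin _ ht w hw (hpr.1.trans hsw)
            have h1 := hpr.card_lt
            have h2 := Finset.card_le_card hsw.1
            rw [← heq] at h2
            omega
          · obtain ⟨k, -, hk, hins⟩ := ProperInitSeg.exists_insert ⟨hσ, he⟩
            refine ⟨insert k σ, hins, hpins k σ hk hσF (hno σ hσ), ?_⟩
            have := (properInitSeg_insert hk).card_lt
            omega
      obtain ⟨σ, hσ, -, hc⟩ := hnext (u.card + 1)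
      have := Finset.card_le_card hσ.1
      omega
    · exact ⟨⟨_, hFne.some_mem⟩, fun u hu => absurd ⟨u, hu⟩ htq⟩
  choose φ hφ using hex
  refine ⟨fun t => x (φ t), ?_, Set.range q, Set.infinite_range_of_injective hq.injective, δ, hδ0,
    hδ, ?_⟩
  · rintro _ ⟨t, rfl⟩
    exact ⟨φ t, rfl⟩
  intro l k hk hkl s hs hpl hl a ha
  have hu : ∀ j, ∃ u : Finset ℕ, (s j : Finset ℕ) = u.image q := by
    intro j
    obtain ⟨u, -, hu⟩ := Finset.subset_set_image_iff.1 (Set.image_univ (f := q) ▸ hs j)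
    exact ⟨u, hu.symm⟩
  choose u hu using hu
  choose σ hσ hφσ using fun j => hφ (s j) (u j) (hu j)
  have hσne : ∀ j, (σ j).Nonempty := by
    intro j
    rw [Finset.nonempty_iff_ne_empty]
    intro h0
    have := hφσ j
    rw [h0, Finset.image_empty] at this
    exact hF0 (this ▸ (φ (s j)).2)
  have hcard : ∀ j, (((σ j).image p).card = (σ j).card) ∧ (((u j).image q).card = (u j).card) ∧
      (σ j).card ≤ (u j).card := fun j =>
    ⟨Finset.card_image_of_injective _ hp.injective, Finset.card_image_of_injective _ hq.injective,
      Finset.card_le_card (hσ j).1⟩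
  have hnp : ∀ j i, i < (σ j).card → nthElem ((σ j).image p : Finset ℕ) i = p (nthElem (σ j) i) :=
    fun j i hi => nthElem_image hp hi
  have hnq : ∀ j i, i < (σ j).card → nthElem ((u j).image q : Finset ℕ) i = q (nthElem (σ j) i) :=
    fun j i hi => by
      rw [nthElem_image hq (hi.trans_le (hcard j).2.2), (hσ j).nthElem_eq hi]
  refine hgen l k hk hkl (fun j => φ (s j)) (fun j => ?_) ?_ ?_ a ha
  · rw [hφσ j]
    intro i hi
    obtain ⟨n, -, rfl⟩ := Finset.mem_image.1 (Finset.mem_coe.1 hi)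
    exact hpM n
  · simp only [hφσ]
    simp only [hu] at hpl
    refine hpl.of_nthElem (fun j => (hσne j).image p) (fun j => ?_) fun i j n n' hn hn' hlt => ?_
    · rw [(hcard j).1, (hcard j).2.1]; exact (hcard j).2.2
    · rw [(hcard _).1] at hn hn'
      rw [hnq i n hn, hnq j n' hn', hq.lt_iff_lt] at hlt
      rw [hnp i n hn, hnp j n' hn']
      exact hp hlt
  · have h0 : 0 < (σ ⟨0, hk⟩).card := (hσne _).card_pos
    rw [hφσ, hnp _ 0 h0]
    rw [hu, hnq _ 0 h0, nthElem_range hq, hq.le_iff_le] at hl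
    exact (nthElem_le_of_strictMono hM hp hpM l).trans (hp.monotone hl)

theorem eq_singleton_empty_of_mem {F : Set (Finset ℕ)} (hF : IsThin F) (h : ∅ ∈ F) : F = {∅} :=
  Set.eq_singleton_iff_unique_mem.2 ⟨h, fun s hs => (hF ∅ h s hs (InitSeg.empty s)).symm⟩

theorem rank_empty_eq_zero {F : Set (Finset ℕ)} (h : WellFounded (TreeExt F)) :
    (h.apply ∅).rank = 0 ↔ F ⊆ {∅} := by
  constructor
  · intro h0 s hs
    by_contra hne
    have := (h.apply ∅).rank_lt_of_rel (b := ∅) (a := s)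
      ⟨subset_segClosure F hs, InitSeg.empty s, fun he => hne he.symm⟩
    rw [h0] at this
    exact absurd this (not_lt.2 (zero_le))
  · intro hF
    rw [(h.apply ∅).rank_eq, ← nonpos_iff_eq_zero]
    refine Ordinal.iSup_le fun ⟨t, ⟨s, hs, hts⟩, ht⟩ => ?_
    have := hF hs
    rw [Set.mem_singleton_iff] at this
    subst this
    exact absurd (Finset.subset_empty.1 hts.1).symm ht.2

theorem exists_admits_of_order_le {F G : Set (Finset ℕ)} (hF : IsRegularThin F)
    (hG : IsRegularThin G) (h1 : 1 ≤ order F) (hle : order F ≤ order G) (x : F → X)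
    (e : Module.Basis ℕ ℝ E) (hx : Admits x e) :
    ∃ x' : G → X, Set.range x' ⊆ Set.range x ∧ Admits x' e := by
  have hne : ∀ H : Set (Finset ℕ), 1 ≤ order H → H.Nonempty := by
    intro H hH
    by_contra hemp
    rw [Set.not_nonempty_iff_eq_empty] at hemp
    rw [order, if_pos hemp] at hH
    exact absurd hH (by simp)
  have hFne := hne F h1
  have hGne := hne G (h1.trans hle)
  rw [order_eq_rank hFne hF.wellFounded, order_eq_rank hGne hG.wellFounded,
    WithBot.coe_le_coe] at hle
  rw [order_eq_rank hFne hF.wellFounded, ← WithBot.coe_one, WithBot.coe_le_coe,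
    Order.one_le_iff_pos] at h1
  refine exists_admits_of_rank_le hF hG hFne hGne (fun h0 => h1.ne' ?_) hle x e hx
  rw [rank_empty_eq_zero hF.wellFounded, eq_singleton_empty_of_mem hF.thin h0]

/-- A regular thin family of order less than `1` is determined by its order. -/
theorem eq_of_order_eq_of_lt_one {F G : Set (Finset ℕ)} (hF : IsRegularThin F)
    (hG : IsRegularThin G) (h1 : order F < 1) (heq : order F = order G) : F = G := by
  have key : ∀ H : Set (Finset ℕ), IsRegularThin H → order H < 1 →
      (H = ∅ ∧ order H = ⊥) ∨ (H = {∅} ∧ order H ≠ ⊥) := by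
    intro H hH hlt
    rcases H.eq_empty_or_nonempty with rfl | hne
    · exact Or.inl ⟨rfl, by rw [order, if_pos rfl]⟩
    · rw [order_eq_rank hne hH.wellFounded] at hlt ⊢
      rw [← WithBot.coe_one, WithBot.coe_lt_coe, Order.lt_one_iff,
        rank_empty_eq_zero hH.wellFounded] at hlt
      exact Or.inr ⟨(Set.subset_singleton_iff_eq.1 hlt).resolve_left hne.ne_empty,
        WithBot.coe_ne_bot⟩
  rcases key F hF h1 with ⟨hF', h⟩ | ⟨hF', h⟩ <;>
    rcases key G hG (heq ▸ h1) with ⟨hG', h'⟩ | ⟨hG', h'⟩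
  · rw [hF', hG']
  · exact absurd (heq ▸ h) h'
  · exact absurd (heq ▸ h') h
  · rw [hF', hG']

theorem IsSpreadingModelOf.of_order_eq {F G : Set (Finset ℕ)} (hF : IsRegularThin F)
    (hG : IsRegularThin G) (heq : order F = order G) {A : Set X} {e : Module.Basis ℕ ℝ E}
    (h : IsSpreadingModelOf F A e) : IsSpreadingModelOf G A e := by
  rcases lt_or_ge (order F) 1 with h1 | h1
  · exact eq_of_order_eq_of_lt_one hF hG h1 heq ▸ h
  · obtain ⟨x, hxA, hx⟩ := h
    obtain ⟨x', hsub, hx'⟩ := exists_admits_of_order_le hF hG h1 heq.le x e hx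
    refine ⟨x', fun t => ?_, hx'⟩
    obtain ⟨s, hs⟩ := hsub ⟨t, rfl⟩
    exact hs ▸ hxA s

/-! ### Regular thin families of prescribed order -/

/-- `α` labels the elements of `s` by strictly decreasing ordinals below `ξ` whose codes under `c`
are bounded by the elements they label. -/
structure IsLabelling (ξ : Ordinal.{0}) (c : Ordinal.{0} → ℕ) (s : Finset ℕ)
    (α : ℕ → Ordinal.{0}) : Prop where
  anti : StrictAntiOn α s
  lt : ∀ n ∈ s, α n < ξ
  code_le : ∀ n ∈ s, c (α n) ≤ n

/-- The finite sets that admit a labelling. -/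
def labelled (ξ : Ordinal.{0}) (c : Ordinal.{0} → ℕ) : Set (Finset ℕ) :=
  {s | ∃ α, IsLabelling ξ c s α}

/-- The maximal elements of a family with respect to initial segments. -/
def segMaximal (R : Set (Finset ℕ)) : Set (Finset ℕ) :=
  {s | s ∈ R ∧ ∀ t ∈ R, InitSeg s t → s = t}

theorem isThin_segMaximal (R : Set (Finset ℕ)) : IsThin (segMaximal R) :=
  fun _ hs t ht => hs.2 t ht.1

/-- Well-foundedness lets every member climb to a maximal one. -/
theorem segClosure_segMaximal {R : Set (Finset ℕ)} (hR : IsHereditary R)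
    (hwf : WellFounded fun t s => t ∈ R ∧ ProperInitSeg s t) :
    segClosure (segMaximal R) = R := by
  ext s
  refine ⟨fun ⟨t, ht, hst⟩ => hR t ht.1 s hst.1, fun hs => ?_⟩
  induction s using hwf.induction with
  | _ s ih =>
    by_cases hmax : s ∈ segMaximal R
    · exact subset_segClosure _ hmax
    · obtain ⟨t, ht, hst, hne⟩ : ∃ t ∈ R, InitSeg s t ∧ s ≠ t := by
        by_contra! hno
        exact hmax ⟨hs, hno⟩
      exact mem_segClosure_of_initSeg (ih t ⟨ht, hst, hne⟩ ht) hst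

/-- Every finite subset of the support of a limit point lies in `R` by heredity. Were the support
infinite, its initial segments would form an infinite branch. -/
theorem isCompactFamily_of_wellFounded {R : Set (Finset ℕ)} (hR : IsHereditary R)
    (hwf : WellFounded fun t s => t ∈ R ∧ ProperInitSeg s t) : IsCompactFamily R := by
  refine isClosed_of_closure_subset fun x hx => ?_
  have hfin : ∀ A : Finset ℕ, (∀ n ∈ A, x n = true) → A ∈ R := by
    intro A hA
    have hopen : IsOpen ((A : Set ℕ).pi fun n => ({x n} : Set Bool)) :=
      isOpen_set_pi A.finite_toSet fun _ _ => isOpen_discrete _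
    obtain ⟨_, hy, s, hs, rfl⟩ := mem_closure_iff.1 hx _ hopen fun _ _ => rfl
    refine hR s hs A fun n hn => ?_
    have : decide (n ∈ s) = x n := hy n hn
    rw [hA n hn] at this
    exact of_decide_eq_true this
  by_cases hU : {n | x n = true}.Finite
  · refine ⟨hU.toFinset, hfin _ fun n hn => by simpa using hn, ?_⟩
    funext n
    cases hxn : x n <;> simp [hxn]
  · exfalso
    have hinf : (Set.ofPred fun n => x n = true).Infinite := hU
    have hmono := Nat.nth_strictMono hinf
    have hmem := Nat.nth_mem_of_infinite hinf
    rw [wellFounded_iff_isEmpty_descending_chain] at hwf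
    refine hwf.elim ⟨fun k => (Finset.range k).image (Nat.nth fun n => x n = true), fun k =>
      ⟨hfin _ fun n hn => ?_, ?_⟩⟩
    · obtain ⟨i, -, rfl⟩ := Finset.mem_image.1 hn
      exact hmem i
    · refine ProperInitSeg.image ?_ hmono
      rw [Finset.range_add_one]
      exact properInitSeg_insert fun a ha => Finset.mem_range.1 ha

section labelled

variable {ξ : Ordinal.{0}} {c : Ordinal.{0} → ℕ}

theorem IsLabelling.mono {s t : Finset ℕ} {α : ℕ → Ordinal.{0}} (h : IsLabelling ξ c s α)
    (hts : t ⊆ s) : IsLabelling ξ c t α :=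
  ⟨h.anti.mono hts, fun n hn => h.lt n (hts hn), fun n hn => h.code_le n (hts hn)⟩

theorem isHereditary_labelled : IsHereditary (labelled ξ c) :=
  fun _ ⟨α, hα⟩ _ hts => ⟨α, hα.mono hts⟩

/-- Labels move along with the elements, and larger elements only relax the bound on codes. -/
theorem isSpreading_labelled : IsSpreading (labelled ξ c) := by
  rintro k n m hn hm hnm ⟨α, hα⟩
  have hmem : ∀ i, n i ∈ Finset.univ.image n := fun i =>
    Finset.mem_image_of_mem n (Finset.mem_univ i)
  refine ⟨Function.extend m (α ∘ n) 0, fun a ha b hb hab => ?_, fun a ha => ?_, fun a ha => ?_⟩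
  · obtain ⟨i, -, rfl⟩ := Finset.mem_image.1 (Finset.mem_coe.1 ha)
    obtain ⟨j, -, rfl⟩ := Finset.mem_image.1 (Finset.mem_coe.1 hb)
    rw [hm.injective.extend_apply, hm.injective.extend_apply]
    exact hα.anti (hmem i) (hmem j) (hn (hm.lt_iff_lt.1 hab))
  · obtain ⟨i, -, rfl⟩ := Finset.mem_image.1 ha
    rw [hm.injective.extend_apply]
    exact hα.lt _ (hmem i)
  · obtain ⟨i, -, rfl⟩ := Finset.mem_image.1 ha
    rw [hm.injective.extend_apply]
    exact (hα.code_le _ (hmem i)).trans (hnm i)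

/-- If `β` bounds strictly every ordinal that can serve as a label after the elements of `s`, then
the rank of `s` in the tree of labelled sets is at most `β`. -/
theorem exists_acc_rank_le (hc : Set.InjOn c (Set.Iio ξ)) (β : Ordinal.{0}) :
    ∀ s : Finset ℕ, (∀ α, IsLabelling ξ c s α → ∀ γ < ξ, (∀ n ∈ s, γ < α n) → γ < β) →
      ∃ h : Acc (fun t s => t ∈ labelled ξ c ∧ ProperInitSeg s t) s, h.rank ≤ β := by
  induction β using WellFoundedLT.induction with
  | _ β ih =>
  intro s hs
  have key : ∀ t, t ∈ labelled ξ c ∧ ProperInitSeg s t → ∃ γ < β,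
      ∃ h : Acc (fun t s => t ∈ labelled ξ c ∧ ProperInitSeg s t) t, h.rank ≤ γ := by
    rintro t ⟨⟨α₀, hα₀⟩, hst⟩
    obtain ⟨m₀, hm₀, -⟩ := hst.exists_insert
    have htne : t.Nonempty := ⟨m₀, hm₀⟩
    have hm := t.max'_mem htne
    have hlast : ∀ n ∈ s, n < t.max' htne := by
      obtain ⟨m₁, hm₁, hlt, -⟩ := hst.exists_insert
      exact fun n hn => (hlt n hn).trans_le (t.le_max' _ hm₁)
    have hlab : ∀ α, IsLabelling ξ c t α → α (t.max' htne) < β := fun α hα =>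
      hs α (hα.mono hst.1.1) _ (hα.lt _ hm) fun n hn =>
        hα.anti (hst.1.1 hn) hm (hlast n hn)
    -- `T` contains every label the last element of `t` can carry. It is finite since `c` is
    -- injective below `ξ`, so its maximum is still below `β` and bounds all later labels strictly.
    let T : Set Ordinal.{0} := {γ | γ < β ∧ γ < ξ ∧ c γ ≤ t.max' htne}
    have hTfin : T.Finite := by
      refine Set.Finite.of_finite_image ((Set.finite_Iic (t.max' htne)).subset ?_)
        (hc.mono fun γ hγ => hγ.2.1)
      rintro _ ⟨γ, hγ, rfl⟩
      exact hγ.2.2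
    have hTne : T.Nonempty := ⟨_, hlab _ hα₀, hα₀.lt _ hm, hα₀.code_le _ hm⟩
    obtain ⟨γ, hγ, hmax⟩ := hTfin.exists_maximalFor id T hTne
    refine ⟨γ, hγ.1, ih γ hγ.1 t fun α hα δ _ hδ => (hδ _ hm).trans_le ?_⟩
    exact le_of_not_gt fun hlt =>
      hlt.not_ge (hmax ⟨hlab _ hα, hα.lt _ hm, hα.code_le _ hm⟩ hlt.le)
  have hacc : Acc (fun t s => t ∈ labelled ξ c ∧ ProperInitSeg s t) s :=
    ⟨_, fun t ht => (key t ht).choose_spec.2.choose⟩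
  refine ⟨hacc, ?_⟩
  rw [hacc.rank_eq]
  refine Ordinal.iSup_le fun ⟨t, ht⟩ => Order.succ_le_of_lt ?_
  obtain ⟨γ, hγ, h, hle⟩ := key t ht
  exact hle.trans_lt hγ

theorem wellFounded_labelled (hc : Set.InjOn c (Set.Iio ξ)) :
    WellFounded fun t s => t ∈ labelled ξ c ∧ ProperInitSeg s t :=
  ⟨fun s => (exists_acc_rank_le hc ξ s fun _ _ _ hγ _ => hγ).1⟩

theorem le_rank_labelled (hwf : WellFounded fun t s => t ∈ labelled ξ c ∧ ProperInitSeg s t)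
    (β : Ordinal.{0}) : ∀ (s : Finset ℕ) (α : ℕ → Ordinal.{0}), β ≤ ξ → IsLabelling ξ c s α →
      (∀ n ∈ s, β ≤ α n) → β ≤ (hwf.apply s).rank := by
  induction β using WellFoundedLT.induction with
  | _ β ih =>
  intro s α hβξ hα hβ
  refine le_of_forall_lt fun γ hγ => ?_
  -- Large enough to come after `s` and to be allowed the label `γ`; each `γ < β` thus gives an
  -- extension of rank at least `γ`.
  let m := max (c γ) (s.sup id + 1)
  have hm : ∀ a ∈ s, a < m := fun a ha =>
    (Nat.lt_succ_of_le (Finset.le_sup (f := id) ha)).trans_le (le_max_right _ _)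
  have hne : ∀ a ∈ s, Function.update α m γ a = α a := fun a ha =>
    Function.update_of_ne (hm a ha).ne _ _
  have hself : Function.update α m γ m = γ := Function.update_self _ _ _
  have hlab : IsLabelling ξ c (insert m s) (Function.update α m γ) := by
    refine ⟨fun a ha b hb hab => ?_, fun a ha => ?_, fun a ha => ?_⟩
    · rcases Finset.mem_insert.1 (Finset.mem_coe.1 ha) with rfl | ha
      · rcases Finset.mem_insert.1 (Finset.mem_coe.1 hb) with rfl | hb
        · exact absurd hab (lt_irrefl _)
        · exact absurd hab (hm b hb).not_gt
      · rw [hne a ha]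
        rcases Finset.mem_insert.1 (Finset.mem_coe.1 hb) with rfl | hb
        · rw [hself]; exact hγ.trans_le (hβ a ha)
        · rw [hne b hb]; exact hα.anti ha hb hab
    · rcases Finset.mem_insert.1 ha with rfl | ha
      · rw [hself]; exact hγ.trans_le hβξ
      · rw [hne a ha]; exact hα.lt a ha
    · rcases Finset.mem_insert.1 ha with rfl | ha
      · rw [hself]; exact le_max_left _ _
      · rw [hne a ha]; exact hα.code_le a ha
  refine (ih γ hγ (insert m s) _ (hγ.le.trans hβξ) hlab fun a ha => ?_).trans_lt
    ((hwf.apply s).rank_lt_of_rel ⟨⟨_, hlab⟩, properInitSeg_insert hm⟩)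
  rcases Finset.mem_insert.1 ha with rfl | ha
  · rw [hself]
  · rw [hne a ha]; exact hγ.le.trans (hβ a ha)

end labelled

theorem exists_injOn_Iio_of_lt_omega_one {ξ : Ordinal.{0}} (hξ : ξ < Ordinal.omega 1) :
    ∃ c : Ordinal.{0} → ℕ, Set.InjOn c (Set.Iio ξ) := by
  have hcount : (Set.Iio ξ).Countable := by
    rw [Cardinal.lt_omega_iff_card_lt, ← Cardinal.succ_aleph0, Order.lt_succ_iff] at hξ
    rw [← Cardinal.le_aleph0_iff_set_countable, Cardinal.mk_Iio_ordinal, Cardinal.lift_le_aleph0]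
    exact hξ
  exact Set.countable_iff_exists_injOn.1 hcount

theorem exists_isRegularThin_order_eq {ξ : Ordinal.{0}} (hξ : ξ < Ordinal.omega 1) :
    ∃ F : Set (Finset ℕ), IsRegularThin F ∧ order F = (ξ : WithBot Ordinal.{0}) := by
  obtain ⟨c, hc⟩ := exists_injOn_Iio_of_lt_omega_one hξ
  have hwf := wellFounded_labelled hc
  have hcl := segClosure_segMaximal isHereditary_labelled hwf
  have hempty : IsLabelling ξ c ∅ 0 := ⟨by simp [StrictAntiOn], by simp, by simp⟩
  have hreg : IsRegularThin (segMaximal (labelled ξ c)) := by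
    refine ⟨isThin_segMaximal _, ?_⟩
    rw [hcl]
    exact ⟨isCompactFamily_of_wellFounded isHereditary_labelled hwf, isHereditary_labelled,
      isSpreading_labelled⟩
  refine ⟨_, hreg, ?_⟩
  have hne : (segMaximal (labelled ξ c)).Nonempty := by
    obtain ⟨s, hs, -⟩ := hcl.ge ⟨0, hempty⟩
    exact ⟨s, hs⟩
  have hrel : TreeExt (segMaximal (labelled ξ c)) =
      fun t s => t ∈ labelled ξ c ∧ ProperInitSeg s t := by
    funext t s
    rw [TreeExt, hcl]
  have hrank : ∀ h : WellFounded (TreeExt (segMaximal (labelled ξ c))),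
      (h.apply ∅).rank = (hwf.apply ∅).rank := by
    rw [hrel]
    exact fun _ => rfl
  rw [order_eq_rank hne hreg.wellFounded, hrank hreg.wellFounded]
  congr 1
  refine le_antisymm ?_ (le_rank_labelled hwf ξ ∅ 0 le_rfl hempty (by simp))
  obtain ⟨_, hle⟩ := exists_acc_rank_le hc ξ ∅ fun _ _ _ hγ _ => hγ
  exact hle

end SpreadingModels

theorem mainTheorem3 {X : Type*} [NormedAddCommGroup X] [NormedSpace ℝ X] [CompleteSpace X]
    {E : Type*} [SeminormedAddCommGroup E] [NormedSpace ℝ E] :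
    (∀ F G : Set (Finset ℕ), SpreadingModels.IsRegularThin F → SpreadingModels.IsRegularThin G →
      1 ≤ SpreadingModels.order F → SpreadingModels.order F ≤ SpreadingModels.order G →
      ∀ (x : F → X) (e : Module.Basis ℕ ℝ E), SpreadingModels.Admits x e →
        ∃ x' : G → X, Set.range x' ⊆ Set.range x ∧ SpreadingModels.Admits x' e) ∧
    (∀ F G : Set (Finset ℕ), SpreadingModels.IsRegularThin F → SpreadingModels.IsRegularThin G →
      SpreadingModels.order F = SpreadingModels.order G →
      ∀ (A : Set X) (e : Module.Basis ℕ ℝ E),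
        SpreadingModels.IsSpreadingModelOf F A e ↔ SpreadingModels.IsSpreadingModelOf G A e) ∧
    (∀ (A : Set X) (ζ ξ : Ordinal.{0}), 1 ≤ ζ → ζ < ξ → ξ < Ordinal.omega 1 →
      SpreadingModels.SM E ζ A ⊆ SpreadingModels.SM E ξ A) := by
  refine ⟨fun F G hF hG h1 hle x e hx =>
    SpreadingModels.exists_admits_of_order_le hF hG h1 hle x e hx,
    fun F G hF hG heq A e => ⟨fun h => h.of_order_eq hF hG heq,
      fun h => h.of_order_eq hG hF heq.symm⟩, ?_⟩
  rintro A ζ ξ hζ hζξ hξ e ⟨F, hF, hFζ, x, hxA, hx⟩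
  obtain ⟨G, hG, hGξ⟩ := SpreadingModels.exists_isRegularThin_order_eq hξ
  have h1 : 1 ≤ SpreadingModels.order F := by
    rw [hFζ, ← WithBot.coe_one, WithBot.coe_le_coe]
    exact hζ
  have hle : SpreadingModels.order F ≤ SpreadingModels.order G := by
    rw [hFζ, hGξ, WithBot.coe_le_coe]
    exact hζξ.le
  obtain ⟨x', hsub, hx'⟩ := SpreadingModels.exists_admits_of_order_le hF hG h1 hle x e hx
  refine ⟨G, hG, hGξ, x', fun t => ?_, hx'⟩
  obtain ⟨s, hs⟩ := hsub ⟨t, rfl⟩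
  exact hs ▸ hxA s
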